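/- Let $k$ be a field of characteristic zero and let $A$ be a finite-dimensional Hopf algebra over $k$ with comultiplication $\Delta$ and bijective antipode $S$. (Cosovereign case.) Let $\Phi : A \to k$ be a sovereign character, i.e. an algebra map with $S^{-1} = \Phi * S * \Phi^{-1}$ for the convolution product, where $\Phi^{-1} = \Phi\circ S$. For a finite-dimensional right $A$-comodule $V$ with dual space $V^*$, let the left dual ${}^\vee V$ be $V^*$ with coaction $\alpha_{{}^\vee V}(v_i^*) = \sum_j v_j^* \otimes S(a_{ij})$, where $(v_i)$ is a basis of $V$ with coaction $v_i \mapsto \sum_j v_j \otimes a_{ji}$, let the right dual $V^\vee$ be $V^*$ with $S$ replaced by $S^{-1}$, and let $\varphi_V = (1\otimes\Phi^{-1})\circ\alpha_{{}^\vee V} : V^\vee \to {}^\vee V$. Put $$\dim^l_\Phi(V) = \varepsilon_V\circ(\varphi_V\otimes 1_V)\circ d_V, \qquad \dim^r_\Phi(V) = e_V\circ(1_V\otimes\varphi_V^{-1})\circ\eta_V,$$ elements of $\mathrm{End}(k)=k$, where $\varepsilon_V : V^*\otimes V\to k$, $e_V : V\otimes V^*\to k$ are the evaluations and $d_V : k\to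 V^*\otimes V$, $\eta_V : k\to V\otimes V^*$ the coevaluations. Consider $A$ as a right comodule over itself via $\Delta$. If $\dim^l_\Phi(A)\neq 0$ or $\dim^r_\Phi(A)\neq 0$, then $S\circ S = 1_A$, and $A$ is semisimple (as a ring) and cosemisimple (the sum of its simple subcoalgebras). (Sovereign case.) Let $\Phi\in A$ be a sovereign element, i.e. a group-like element with $S^{-1}(a) = \Phi S(a)\Phi^{-1}$ for all $a\in A$. For a finite-dimensional left $A$-module $V$ let the left dual ${}^\vee V$ be $V^*$ with $(a f)(v) = f(S(a)v)$, let the right dual $V^\vee$ be $V^*$ with $(a f)(v) = f(S^{-1}(a)v)$, let $\varphi_V : V^\vee\to{}^\vee V$ be given by the action of $\Phi^{-1}$ on ${}^\vee V$, that is $\varphi_V(f) = f(\Phi\,\cdot)$, and define $\dim^l_\Phi(V)$, $\dim^r_\Phi(V)$ by the same formulas. Consider $A$ as a left module over itself by multiplication. If $\dim^l_\Phi(A)\neq 0$ or $\dim^r_\Phi(A)\neq 0$, then again $S\circ S = 1_A$, and $A$ is semisimple and cosemisimple. -/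

import Mathlib

open scoped TensorProduct

noncomputable section

namespace SovereignHopf

open TensorProduct Coalgebra HopfAlgebra WithConv

/-! ### Right comodules -/

/-- A right comodule structure on the vector space `V` over the coalgebra `A`. -/
structure RightComodule (k A V : Type*) [Field k] [AddCommGroup A] [Module k A] [Coalgebra k A]
    [AddCommGroup V] [Module k V] where
  coact : V →ₗ[k] V ⊗[k] A
  coassoc : (TensorProduct.assoc k V A A).toLinearMap ∘ₗ coact.rTensor A ∘ₗ coact =
    (comul (R := k) (A := A)).lTensor V ∘ₗ coact
  counit_coact : (TensorProduct.rid k V).toLinearMap ∘ₗ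
    (counit (R := k) (A := A)).lTensor V ∘ₗ coact = LinearMap.id

namespace RightComodule

/-- The coalgebra `A` as a right comodule over itself via the comultiplication. -/
def regular (k A : Type*) [Field k] [AddCommGroup A] [Module k A] [Coalgebra k A] :
    RightComodule k A A where
  coact := comul
  coassoc := Coalgebra.coassoc
  counit_coact := by
    rw [Coalgebra.lTensor_counit_comp_comul]
    ext a
    simp

section

variable {k A V : Type*} [Field k] [AddCommGroup A] [Module k A] [Coalgebra k A]
  [AddCommGroup V] [Module k V]

/-- The operator `v ↦ ∑ χ(v₁) v₀` on a right comodule given by a linear form `χ` on `A`. -/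
def act (M : RightComodule k A V) (χ : A →ₗ[k] k) : V →ₗ[k] V :=
  (TensorProduct.rid k V).toLinearMap ∘ₗ χ.lTensor V ∘ₗ M.coact

theorem act_one (M : RightComodule k A V) :
    M.act (1 : WithConv (A →ₗ[k] k)).ofConv = LinearMap.id := M.counit_coact

theorem act_comp_act (M : RightComodule k A V) (χ ψ : A →ₗ[k] k) :
    M.act χ ∘ₗ M.act ψ = M.act (toConv χ * toConv ψ).ofConv := by
  have h : M.act (toConv χ * toConv ψ).ofConv =
      (TensorProduct.rid k V).toLinearMap ∘ₗ
        (LinearMap.mul' k k ∘ₗ TensorProduct.map χ ψ).lTensor V ∘ₗ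
        ((TensorProduct.assoc k V A A).toLinearMap ∘ₗ M.coact.rTensor A ∘ₗ M.coact) := by
    rw [M.coassoc, ← LinearMap.comp_assoc M.coact, ← LinearMap.lTensor_comp]
    rfl
  have h2 : (TensorProduct.rid k V).toLinearMap ∘ₗ
        (LinearMap.mul' k k ∘ₗ TensorProduct.map χ ψ).lTensor V ∘ₗ
        (TensorProduct.assoc k V A A).toLinearMap =
      (TensorProduct.rid k V).toLinearMap ∘ₗ
        TensorProduct.map ((TensorProduct.rid k V).toLinearMap ∘ₗ χ.lTensor V) ψ := by
    ext v a b
    simp [smul_smul, mul_comm]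
  rw [h]
  ext v
  have h3 := LinearMap.congr_fun h2 ((M.coact.rTensor A) (M.coact v))
  simp only [LinearMap.comp_apply] at h3 ⊢
  rw [h3]
  simp only [act, LinearMap.comp_apply]
  generalize M.coact v = t
  induction t with
  | zero => simp
  | add x y hx hy => simp only [map_add, hx, hy]
  | tmul v a => simp

end

section Dual

variable {k A V : Type*} [Field k] [Ring A] [HopfAlgebra k A]
  [AddCommGroup V] [Module k V] [FiniteDimensional k V]

/-- The coaction of the left dual comodule `ᵛV`, whose underlying space is `V*`.
The element of `V* ⊗ A` attached to `f` is the one that corresponds to the linear map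
`v ↦ ∑ f(v₀) S(v₁)` under `V* ⊗ A ≃ Hom(V, A)`; if `α(vᵢ) = ∑ⱼ vⱼ ⊗ aⱼᵢ` on a basis,
then `vᵢ* ↦ ∑ⱼ vⱼ* ⊗ S(aᵢⱼ)`. -/
def leftDualCoact (M : RightComodule k A V) :
    Module.Dual k V →ₗ[k] Module.Dual k V ⊗[k] A where
  toFun f := (dualTensorHomEquiv k V A).symm
    (antipode k ∘ₗ (TensorProduct.lid k A).toLinearMap ∘ₗ f.rTensor A ∘ₗ M.coact)
  map_add' f g := by
    rw [← map_add]
    simp [LinearMap.rTensor_add, LinearMap.add_comp, LinearMap.comp_add]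
  map_smul' c f := by
    rw [RingHom.id_apply, ← map_smul]
    simp [LinearMap.rTensor_smul, LinearMap.smul_comp, LinearMap.comp_smul]

/-- The map `(1 ⊗ χ) ∘ α` for the coaction `α` of the left dual comodule. -/
def leftDualAct (M : RightComodule k A V) (χ : A →ₗ[k] k) :
    Module.Dual k V →ₗ[k] Module.Dual k V :=
  (TensorProduct.rid k (Module.Dual k V)).toLinearMap ∘ₗ
    χ.lTensor (Module.Dual k V) ∘ₗ M.leftDualCoact

theorem leftDualAct_eq (M : RightComodule k A V) (χ : A →ₗ[k] k) :
    M.leftDualAct χ = (M.act (χ ∘ₗ antipode k)).dualMap := by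
  have key : ∀ t : Module.Dual k V ⊗[k] A,
      TensorProduct.rid k (Module.Dual k V) (χ.lTensor (Module.Dual k V) t) =
        χ ∘ₗ dualTensorHomEquiv k V A t := by
    intro t
    induction t with
    | zero => simp
    | add x y hx hy => simp only [map_add, hx, hy, LinearMap.comp_add]
    | tmul f a =>
      ext v
      simp [dualTensorHomEquiv, mul_comm]
  ext f v
  have h := LinearMap.congr_fun (key (M.leftDualCoact f)) v
  simp only [leftDualAct, LinearMap.comp_apply, LinearEquiv.coe_coe] at h ⊢
  rw [h]
  simp only [leftDualCoact, LinearMap.coe_mk, AddHom.coe_mk, LinearEquiv.apply_symm_apply,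
    LinearMap.comp_apply, LinearEquiv.coe_coe, act, LinearMap.dualMap_apply]
  generalize M.coact v = t
  induction t with
  | zero => simp
  | add x y hx hy => simp only [map_add, hx, hy]
  | tmul w a => simp [mul_comm]

end Dual

end RightComodule

/-! ### Dimensions -/

section Dim

variable {k V : Type*} [Field k] [AddCommGroup V] [Module k V] [FiniteDimensional k V]

/-- The left dimension `ε_V ∘ (φ_V ⊗ 1_V) ∘ d_V`, an endomorphism of the unit object `k`.
Here `φ` is the component at `V` of the sovereign structure, from the right dual to the left
dual; both have underlying space `V*`, and `ε_V : V* ⊗ V → k`, `d_V : k → V* ⊗ V` are the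
classical evaluation and coevaluation. -/
def leftDim (φ : Module.Dual k V ≃ₗ[k] Module.Dual k V) : k →ₗ[k] k :=
  contractLeft k V ∘ₗ φ.toLinearMap.rTensor V ∘ₗ
    (TensorProduct.comm k V (Module.Dual k V)).toLinearMap ∘ₗ coevaluation k V

/-- The right dimension `e_V ∘ (1_V ⊗ φ_V⁻¹) ∘ η_V`, an endomorphism of the unit object `k`,
with the classical `e_V : V ⊗ V* → k` and `η_V : k → V ⊗ V*`. -/
def rightDim (φ : Module.Dual k V ≃ₗ[k] Module.Dual k V) : k →ₗ[k] k :=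
  contractRight k V ∘ₗ φ.symm.toLinearMap.lTensor V ∘ₗ coevaluation k V

end Dim

section Hopf

variable {k A : Type*} [Field k] [Ring A] [HopfAlgebra k A]

/-! ### Cosovereign Hopf algebras -/

/-- The inverse `Φ ∘ S` of a character `Φ` for the convolution product. -/
def charInv (Φ : A →ₐ[k] k) : A →ₐ[k] k :=
  AlgHom.ofLinearMap (Φ.toLinearMap ∘ₗ antipode k) (by simp)
    (fun a b => by simp [antipode_mul_antidistrib, mul_comm])

theorem charInv_apply (Φ : A →ₐ[k] k) (a : A) : charInv Φ a = Φ (antipode k a) := rfl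

theorem charInv_mul (Φ : A →ₐ[k] k) :
    toConv (charInv Φ).toLinearMap * toConv Φ.toLinearMap = 1 := by
  ext a
  rw [(ℛ k a).convMul_apply]
  have h := congrArg Φ (sum_antipode_mul_eq_algebraMap_counit (ℛ k a))
  simpa [charInv_apply] using h

theorem mul_charInv (Φ : A →ₐ[k] k) :
    toConv Φ.toLinearMap * toConv (charInv Φ).toLinearMap = 1 := by
  ext a
  rw [(ℛ k a).convMul_apply]
  have h := congrArg Φ (sum_mul_antipode_eq_algebraMap_counit (ℛ k a))
  simpa [charInv_apply] using h

variable (k A) in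
/-- A sovereign character on a Hopf algebra with bijective antipode: a character `Φ` such that
`S⁻¹ = Φ * S * Φ⁻¹` for the convolution product, linear forms being regarded as `A`-valued
maps through the unit `k → A`. -/
structure SovereignCharacter where
  char : A →ₐ[k] k
  bijective : Function.Bijective (antipode k : A →ₗ[k] A)
  inv_antipode :
    toConv ((LinearEquiv.ofBijective (antipode k : A →ₗ[k] A) bijective).symm : A →ₗ[k] A) =
      toConv (Algebra.linearMap k A ∘ₗ char.toLinearMap) * toConv (antipode k) *
        toConv (Algebra.linearMap k A ∘ₗ (charInv char).toLinearMap)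

namespace SovereignCharacter

variable {V : Type*} [AddCommGroup V] [Module k V] [FiniteDimensional k V]

/-- The sovereign structure on the finite-dimensional right comodules: the isomorphism
`φ_V = (1 ⊗ Φ⁻¹) ∘ α` from the right dual to the left dual of `V`, where `α` is the coaction
of the left dual. -/
def iso (Φ : SovereignCharacter k A) (M : RightComodule k A V) :
    Module.Dual k V ≃ₗ[k] Module.Dual k V :=
  LinearEquiv.ofLinearMap (M.leftDualAct (charInv Φ.char).toLinearMap)
    (M.leftDualAct Φ.char.toLinearMap)
    (by
      rw [M.leftDualAct_eq, M.leftDualAct_eq, LinearMap.dualMap_comp_dualMap, M.act_comp_act]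
      have h := mul_charInv (charInv Φ.char)
      rw [← LinearMap.dualMap_id, ← M.act_one, ← h]
      rfl)
    (by
      rw [M.leftDualAct_eq, M.leftDualAct_eq, LinearMap.dualMap_comp_dualMap, M.act_comp_act]
      have h := charInv_mul (charInv Φ.char)
      rw [← LinearMap.dualMap_id, ← M.act_one, ← h]
      rfl)

/-- The left dimension of a finite-dimensional right comodule. -/
def leftDim (Φ : SovereignCharacter k A) (M : RightComodule k A V) : k →ₗ[k] k :=
  SovereignHopf.leftDim (Φ.iso M)

/-- The right dimension of a finite-dimensional right comodule. -/
def rightDim (Φ : SovereignCharacter k A) (M : RightComodule k A V) : k →ₗ[k] k :=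
  SovereignHopf.rightDim (Φ.iso M)

end SovereignCharacter

/-! ### Sovereign Hopf algebras -/

variable (k A) in
/-- A sovereign element of a Hopf algebra with bijective antipode: a group-like element `Φ`
such that `S⁻¹(a) = Φ S(a) Φ⁻¹` for all `a`. -/
structure SovereignElement where
  elem : GroupLike k A
  bijective : Function.Bijective (antipode k : A →ₗ[k] A)
  inv_antipode : ∀ a : A,
    (LinearEquiv.ofBijective (antipode k : A →ₗ[k] A) bijective).symm a =
      (elem : A) * antipode k a * ((elem⁻¹ : GroupLike k A) : A)

/-- The action of `a` on the left dual of the left module `V`: `(a • f)(v) = f(S(a) • v)`. -/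
def leftDualSMul (k : Type*) {A : Type*} [Field k] [Ring A] [HopfAlgebra k A] (V : Type*)
    [AddCommGroup V] [Module k V] [Module A V] [IsScalarTower k A V] (a : A) :
    Module.Dual k V →ₗ[k] Module.Dual k V :=
  (Algebra.lsmul k k V (antipode k a)).dualMap

namespace SovereignElement

variable (Φ : SovereignElement k A) (V : Type*) [AddCommGroup V] [Module k V] [Module A V]
  [IsScalarTower k A V]

/-- The sovereign structure on the finite-dimensional left modules: the isomorphism
`φ_V` from the right dual to the left dual of `V` given by the action of `Φ⁻¹` on the left dual,
that is, `f ↦ f(Φ • -)`. -/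
def iso : Module.Dual k V ≃ₗ[k] Module.Dual k V :=
  LinearEquiv.ofLinearMap (leftDualSMul k V ((Φ.elem⁻¹ : GroupLike k A) : A))
    (leftDualSMul k V (Φ.elem : A))
    (by
      ext f v
      simp [leftDualSMul, smul_smul, Φ.elem.2])
    (by
      ext f v
      simp [leftDualSMul, smul_smul, Φ.elem.2])

variable [FiniteDimensional k V]

/-- The left dimension of a finite-dimensional left module. -/
def leftDim : k →ₗ[k] k := SovereignHopf.leftDim (Φ.iso V)

/-- The right dimension of a finite-dimensional left module. -/
def rightDim : k →ₗ[k] k := SovereignHopf.rightDim (Φ.iso V)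

end SovereignElement

end Hopf

/-! ### Cosemisimple coalgebras -/

section Cosemisimple

variable {k C : Type*} [Field k] [AddCommGroup C] [Module k C] [Coalgebra k C]

/-- A subspace `D` is a subcoalgebra if `Δ(D) ⊆ D ⊗ D`. -/
def IsSubcoalgebra (D : Submodule k C) : Prop :=
  ∀ x ∈ D, comul (R := k) x ∈ LinearMap.range (TensorProduct.map D.subtype D.subtype)

/-- A simple subcoalgebra: nonzero, with no subcoalgebras except `0` and itself. -/
def IsSimpleSubcoalgebra (D : Submodule k C) : Prop :=
  IsSubcoalgebra D ∧ D ≠ ⊥ ∧ ∀ E ≤ D, IsSubcoalgebra E → E = ⊥ ∨ E = D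

variable (k C) in
/-- A coalgebra is cosemisimple if it is the sum of its simple subcoalgebras. -/
def IsCosemisimple : Prop :=
  sSup {D : Submodule k C | IsSimpleSubcoalgebra D} = ⊤

end Cosemisimple

end SovereignHopf

end

/-! In a finite-dimensional Hopf algebra, traces twisted by `S²` or `S⁻²` produce integrals. For a
linear form `f` let `leftHit f` be `a ↦ ∑ f(a₁)a₂`. Then `f ↦ tr(leftHit f ∘ S²)`, seen as an
element of `A`, is a left integral in `A`, and `a ↦ tr(x ↦ S⁻²(x)a)` is an integral on `A`.
Exchanging `S²` with `S⁻²` and left with right gives the two companion statements. All four rest on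
the antipode axioms and cyclicity of the trace (`trace_leftHit_comp_mulLeft`,
`trace_mulRight_leftHit` and their mirror images).

The sovereign condition expresses `S²` through `Φ`, so that the left dimension of `A` becomes the
value of such an integral at `Φ`, and the right dimension the value of its companion at `Φ⁻¹`. In
the cosovereign case multiplicativity of `Φ` gives `Φ(a)t = ε(a)t` with `t` the dimension; in the
sovereign case group-likeness gives `f(Φ)t = f(1)t` for every form `f`; for the right dimension
`Φ⁻¹` replaces `Φ`. If `t ≠ 0`, then `Φ` is trivial, hence `S⁻¹ = S`.

Once `S² = 1`, the same integrals take the value `dim A` at `ε` and at `1`, which is nonzero in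
characteristic zero. Maschke's argument, run with the separability idempotent built from an
integral, makes both `A` and its dual algebra semisimple on the module `A`. For the dual algebra,
the isotypic components of `A` are simple subcoalgebras that span `A`. -/

noncomputable section

namespace SovereignHopf

open TensorProduct Coalgebra HopfAlgebra WithConv

/-! ### Actions of linear forms on a coalgebra. -/

section Hit

variable {k A ι : Type*} [Field k] [AddCommGroup A] [Module k A] [Coalgebra k A]

/-- The operator `a ↦ ∑ f(a₁) a₂` on a coalgebra. -/
def leftHit (f : A →ₗ[k] k) : A →ₗ[k] A :=
  (TensorProduct.lid k A).toLinearMap ∘ₗ f.rTensor A ∘ₗ comul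

/-- The operator `a ↦ ∑ f(a₂) a₁` on a coalgebra. -/
def rightHit (f : A →ₗ[k] k) : A →ₗ[k] A :=
  (RightComodule.regular k A).act f

theorem leftHit_apply (f : A →ₗ[k] k) {a : A} (r : Repr k a ι) :
    leftHit f a = ∑ i ∈ r.index, f (r.left i) • r.right i := by
  simp [leftHit, ← r.eq]

theorem rightHit_apply (f : A →ₗ[k] k) {a : A} (r : Repr k a ι) :
    rightHit f a = ∑ i ∈ r.index, f (r.right i) • r.left i := by
  simp [rightHit, RightComodule.act, RightComodule.regular, ← r.eq]

theorem leftHit_sum (s : Finset ι) (f : ι → A →ₗ[k] k) :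
    leftHit (∑ i ∈ s, f i) = ∑ i ∈ s, leftHit (f i) := by
  ext x
  simp only [leftHit_apply _ (ℛ k x), LinearMap.sum_apply, Finset.sum_smul]
  exact Finset.sum_comm

theorem rightHit_sum (s : Finset ι) (f : ι → A →ₗ[k] k) :
    rightHit (∑ i ∈ s, f i) = ∑ i ∈ s, rightHit (f i) := by
  ext x
  simp only [rightHit_apply _ (ℛ k x), LinearMap.sum_apply, Finset.sum_smul]
  exact Finset.sum_comm

theorem leftHit_smul (c : k) (f : A →ₗ[k] k) : leftHit (c • f) = c • leftHit f := by
  ext x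
  simp only [leftHit_apply _ (ℛ k x), LinearMap.smul_apply, Finset.smul_sum, smul_assoc]

theorem rightHit_smul (c : k) (f : A →ₗ[k] k) : rightHit (c • f) = c • rightHit f := by
  ext x
  simp only [rightHit_apply _ (ℛ k x), LinearMap.smul_apply, Finset.smul_sum, smul_assoc]

/-- This is coassociativity, read as: `leftHit f` is an endomorphism of the right comodule `A`. -/
theorem comul_leftHit (f : A →ₗ[k] k) (a : A) :
    comul (R := k) (leftHit f a) = (leftHit f).rTensor A (comul a) := by
  have h1 : ∀ t : A ⊗[k] A, comul (R := k) (TensorProduct.lid k A (f.rTensor A t)) =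
      TensorProduct.lid k (A ⊗[k] A) (f.rTensor (A ⊗[k] A) (comul.lTensor A t)) := by
    intro t
    induction t with
    | zero => simp
    | add x y hx hy => simp only [map_add, hx, hy]
    | tmul u v => simp
  have h2 : ∀ (v : A) (t : A ⊗[k] A),
      TensorProduct.lid k (A ⊗[k] A) (f.rTensor (A ⊗[k] A)
        (TensorProduct.assoc k A A A (t ⊗ₜ v))) =
      TensorProduct.lid k A (f.rTensor A t) ⊗ₜ v := by
    intro v t
    induction t with
    | zero => simp
    | add x y hx hy => simp only [map_add, TensorProduct.add_tmul, hx, hy]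
    | tmul u w => simp [TensorProduct.smul_tmul']
  have h3 : ∀ t : A ⊗[k] A, TensorProduct.lid k (A ⊗[k] A) (f.rTensor (A ⊗[k] A)
      (TensorProduct.assoc k A A A (comul.rTensor A t))) = (leftHit f).rTensor A t := by
    intro t
    induction t with
    | zero => simp
    | add x y hx hy => simp only [map_add, hx, hy]
    | tmul u v => simpa [leftHit] using h2 v (comul u)
  rw [← h3, coassoc_apply, ← h1]
  rfl

theorem leftHit_counit : leftHit (counit : A →ₗ[k] k) = LinearMap.id := by
  ext a
  simp [leftHit]

theorem rightHit_counit : rightHit (counit : A →ₗ[k] k) = LinearMap.id :=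
  (RightComodule.regular k A).counit_coact

theorem rightHit_mul (f g : A →ₗ[k] k) :
    rightHit (toConv f * toConv g).ofConv = rightHit f ∘ₗ rightHit g :=
  ((RightComodule.regular k A).act_comp_act f g).symm

/-- The two kinds of operators commute. -/
theorem rightHit_leftHit (f g : A →ₗ[k] k) (a : A) :
    rightHit f (leftHit g a) = leftHit g (rightHit f a) := by
  have h : ∀ t : A ⊗[k] A, TensorProduct.rid k A (f.lTensor A ((leftHit g).rTensor A t)) =
      leftHit g (TensorProduct.rid k A (f.lTensor A t)) := by
    intro t
    induction t with
    | zero => simp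
    | add x y hx hy => simp only [map_add, hx, hy]
    | tmul u v => simp
  have := h (comul a)
  rw [← comul_leftHit] at this
  exact this

theorem conv_eq_comp_leftHit (f g : A →ₗ[k] k) :
    (toConv f * toConv g).ofConv = g ∘ₗ leftHit f := by
  ext a
  change (toConv f * toConv g) a = _
  rw [(ℛ k a).convMul_apply, LinearMap.comp_apply, leftHit_apply f (ℛ k a)]
  simp

theorem conv_eq_comp_rightHit (f g : A →ₗ[k] k) :
    (toConv f * toConv g).ofConv = f ∘ₗ rightHit g := by
  ext a
  change (toConv f * toConv g) a = _
  rw [(ℛ k a).convMul_apply, LinearMap.comp_apply, rightHit_apply g (ℛ k a)]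
  simp [mul_comm]

theorem counit_comp_leftHit (f : A →ₗ[k] k) : counit ∘ₗ leftHit f = f := by
  rw [← conv_eq_comp_leftHit]
  exact congrArg WithConv.ofConv (mul_one (toConv f))

theorem counit_leftHit (f : A →ₗ[k] k) (a : A) : counit (R := k) (leftHit f a) = f a :=
  LinearMap.congr_fun (counit_comp_leftHit f) a

/-- The order is reversed, unlike for `rightHit`: the operator applied first consumes the leftmost
Sweedler factor. -/
theorem leftHit_mul (f g : A →ₗ[k] k) :
    leftHit (toConv f * toConv g).ofConv = leftHit g ∘ₗ leftHit f := by
  ext a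
  rw [conv_eq_comp_leftHit]
  simp only [LinearMap.comp_apply]
  conv_rhs => rw [leftHit, LinearMap.comp_apply, LinearMap.comp_apply, comul_leftHit,
    ← LinearMap.comp_apply (LinearMap.rTensor A g), ← LinearMap.rTensor_comp]
  rfl

end Hit

/-! ### Hits of products. -/

section Bialgebra

variable {k A ι : Type*} [Field k] [Ring A] [HopfAlgebra k A]

theorem leftHit_mul_apply (f : A →ₗ[k] k) (u : A) {x : A} (r : Repr k x ι) :
    leftHit f (u * x) =
      ∑ j ∈ r.index, leftHit (f ∘ₗ LinearMap.mulRight k (r.left j)) u * r.right j := by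
  have h : ∀ t : A ⊗[k] A, ∑ j ∈ r.index,
      TensorProduct.lid k A ((f ∘ₗ LinearMap.mulRight k (r.left j)).rTensor A t) * r.right j =
      TensorProduct.lid k A (f.rTensor A (t * comul x)) := by
    intro t
    induction t with
    | zero => simp
    | add y z hy hz => simp only [map_add, add_mul, Finset.sum_add_distrib, hy, hz]
    | tmul v w => simp [← r.eq, Finset.mul_sum]
  simpa [leftHit] using (h (comul u)).symm

theorem leftHit_mul_apply_left (f : A →ₗ[k] k) (u : A) {x : A} (r : Repr k x ι) :
    leftHit f (x * u) =
      ∑ j ∈ r.index, r.right j * leftHit (f ∘ₗ LinearMap.mulLeft k (r.left j)) u := by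
  have h : ∀ t : A ⊗[k] A, ∑ j ∈ r.index,
      r.right j * TensorProduct.lid k A ((f ∘ₗ LinearMap.mulLeft k (r.left j)).rTensor A t) =
      TensorProduct.lid k A (f.rTensor A (comul x * t)) := by
    intro t
    induction t with
    | zero => simp
    | add y z hy hz => simp only [map_add, mul_add, Finset.sum_add_distrib, hy, hz]
    | tmul v w => simp [← r.eq, Finset.sum_mul]
  simpa [leftHit] using (h (comul u)).symm

theorem rightHit_mul_apply (f : A →ₗ[k] k) (u : A) {x : A} (r : Repr k x ι) :
    rightHit f (u * x) =
      ∑ j ∈ r.index, rightHit (f ∘ₗ LinearMap.mulRight k (r.right j)) u * r.left j := by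
  have h : ∀ t : A ⊗[k] A, ∑ j ∈ r.index,
      TensorProduct.rid k A ((f ∘ₗ LinearMap.mulRight k (r.right j)).lTensor A t) * r.left j =
      TensorProduct.rid k A (f.lTensor A (t * comul x)) := by
    intro t
    induction t with
    | zero => simp
    | add y z hy hz => simp only [map_add, add_mul, Finset.sum_add_distrib, hy, hz]
    | tmul v w => simp [← r.eq, Finset.mul_sum]
  simpa [rightHit, RightComodule.act, RightComodule.regular] using (h (comul u)).symm

/-- In Sweedler notation `∑ h(a₁) a₂ S(a₃) = h(a)`: the antipode axiom at the element `leftHit h a`.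
-/
theorem sum_leftHit_mul_antipode (h : A →ₗ[k] k) {a : A} (r : Repr k a ι) :
    ∑ i ∈ r.index, leftHit h (r.left i) * antipode k (r.right i) = algebraMap k A (h a) := by
  have := mul_antipode_lTensor_comul_apply (R := k) (leftHit h a)
  rw [comul_leftHit, ← r.eq, counit_leftHit] at this
  simpa using this

end Bialgebra

theorem sum_comp {k U V W ι : Type*} [CommSemiring k] [AddCommMonoid U] [AddCommMonoid V]
    [AddCommMonoid W] [Module k U] [Module k V] [Module k W] (s : Finset ι) (f : ι → V →ₗ[k] W)
    (g : U →ₗ[k] V) : (∑ i ∈ s, f i) ∘ₗ g = ∑ i ∈ s, f i ∘ₗ g := by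
  ext x
  simp

theorem comp_sum {k U V W ι : Type*} [CommSemiring k] [AddCommMonoid U] [AddCommMonoid V]
    [AddCommMonoid W] [Module k U] [Module k V] [Module k W] (s : Finset ι) (f : ι → U →ₗ[k] V)
    (g : V →ₗ[k] W) : g ∘ₗ (∑ i ∈ s, f i) = ∑ i ∈ s, g ∘ₗ f i := by
  ext x
  simp

/-! ### Identities for the antipode and its inverse `S'`. -/

section InverseAntipode

variable {k A ι : Type*} [Field k] [Ring A] [HopfAlgebra k A] {S' : A →ₗ[k] A}

theorem antipode_algebraMap (c : k) : antipode k (algebraMap k A c) = algebraMap k A c := by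
  rw [Algebra.algebraMap_eq_smul_one, map_smul, antipode_one]

theorem invAntipode_mul (h : ∀ a, antipode k (S' a) = a) (h' : ∀ a, S' (antipode k a) = a)
    (a b : A) : S' (a * b) = S' b * S' a := by
  conv_lhs => rw [← h a, ← h b, ← antipode_mul_antidistrib, h']

/-- Apply `S'`, which reverses products, to `∑ S(a₁)a₂ = ε(a)`; the result is `∑ S'(a₂)a₁ = ε(a)`.
-/
theorem mul_invAntipode_comul (h : ∀ a, antipode k (S' a) = a)
    (h' : ∀ a, S' (antipode k a) = a) (a : A) :
    LinearMap.mul' k A (S'.rTensor A (TensorProduct.comm k A A (comul a))) =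
      algebraMap k A (counit a) := by
  rw [← h' (LinearMap.mul' k A _), ← h' (algebraMap k A _), antipode_algebraMap,
    ← sum_antipode_mul_eq_algebraMap_counit (ℛ k a), ← (ℛ k a).eq]
  simp [antipode_mul_antidistrib, h]

theorem sum_invAntipode_mul (h : ∀ a, antipode k (S' a) = a)
    (h' : ∀ a, S' (antipode k a) = a) {a : A} (r : Repr k a ι) :
    ∑ i ∈ r.index, S' (r.right i) * r.left i = algebraMap k A (counit a) := by
  rw [← mul_invAntipode_comul h h', ← r.eq]
  simp

theorem sum_invAntipode_mul_leftHit (h : ∀ a, antipode k (S' a) = a)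
    (h' : ∀ a, S' (antipode k a) = a) (f : A →ₗ[k] k) {a : A} (r : Repr k a ι) :
    ∑ i ∈ r.index, S' (r.right i) * leftHit f (r.left i) = algebraMap k A (f a) := by
  have := mul_invAntipode_comul h h' (leftHit f a)
  rw [comul_leftHit, ← r.eq, counit_leftHit] at this
  simpa using this

/-- Expanding the right side gives `∑ S'(a₃) f(a₁x₁) a₂x₂`, where `S'(a₃)a₂` collapses. The operator
`leftHit f` is thus isolated between multiplications, ready for cyclicity of the trace. -/
theorem leftHit_comp_mulLeft (h : ∀ a, antipode k (S' a) = a)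
    (h' : ∀ a, S' (antipode k a) = a) (f : A →ₗ[k] k) {a : A} (r : Repr k a ι) :
    leftHit (f ∘ₗ LinearMap.mulLeft k a) = ∑ i ∈ r.index,
      LinearMap.mulLeft k (S' (r.right i)) ∘ₗ leftHit f ∘ₗ LinearMap.mulLeft k (r.left i) := by
  ext x
  simp only [LinearMap.sum_apply, LinearMap.comp_apply, LinearMap.mulLeft_apply,
    leftHit_mul_apply f _ (ℛ k x), Finset.mul_sum, ← mul_assoc]
  rw [Finset.sum_comm]
  simp only [← Finset.sum_mul, sum_invAntipode_mul_leftHit h h', ← Algebra.smul_def]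
  exact leftHit_apply _ _

theorem leftHit_comp_mulRight (f : A →ₗ[k] k) {a : A} (r : Repr k a ι) :
    leftHit (f ∘ₗ LinearMap.mulRight k a) = ∑ i ∈ r.index,
      LinearMap.mulRight k (antipode k (r.right i)) ∘ₗ leftHit f ∘ₗ
        LinearMap.mulRight k (r.left i) := by
  ext x
  simp only [LinearMap.sum_apply, LinearMap.comp_apply, LinearMap.mulRight_apply,
    leftHit_mul_apply_left f _ (ℛ k x), Finset.sum_mul, mul_assoc]
  rw [Finset.sum_comm]
  simp only [← Finset.mul_sum, sum_leftHit_mul_antipode, ← Algebra.commutes,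
    ← Algebra.smul_def]
  exact leftHit_apply _ _

/-- The comultiplication of `f` in the dual Hopf algebra, written with a basis and its dual basis.
-/
theorem apply_mul_eq_sum {ι : Type*} [Fintype ι] (b : Module.Basis ι k A) (f : A →ₗ[k] k)
    (u v : A) :
    f (u * v) = ∑ m, (f ∘ₗ LinearMap.mulRight k (b m)) u * b.coord m v := by
  conv_lhs => rw [← b.sum_repr v]
  rw [Finset.mul_sum, map_sum]
  simp [mul_comm]

/-- Summing over the basis recombines the terms into `∑ f(S'(z₂)z₁q)`. -/
theorem sum_conv_invAntipode {ι : Type*} [Fintype ι] (b : Module.Basis ι k A)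
    (h : ∀ a, antipode k (S' a) = a) (h' : ∀ a, S' (antipode k a) = a)
    (f : A →ₗ[k] k) (q : A) :
    ∑ m, (toConv (b.coord m ∘ₗ LinearMap.mulRight k q) *
      toConv ((f ∘ₗ LinearMap.mulRight k (b m)) ∘ₗ S')).ofConv = f q • counit := by
  ext z
  have e : ∀ m, (toConv (b.coord m ∘ₗ LinearMap.mulRight k q) *
      toConv ((f ∘ₗ LinearMap.mulRight k (b m)) ∘ₗ S')).ofConv z =
      ∑ i ∈ (ℛ k z).index, b.coord m ((ℛ k z).left i * q) *
        (f ∘ₗ LinearMap.mulRight k (b m)) (S' ((ℛ k z).right i)) := fun m =>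
    (ℛ k z).convMul_apply _ _
  rw [LinearMap.sum_apply]
  simp only [e]
  rw [Finset.sum_comm]
  simp only [mul_comm (b.coord _ _), ← apply_mul_eq_sum, ← mul_assoc, ← map_sum,
    ← Finset.sum_mul, sum_invAntipode_mul h h', ← Algebra.smul_def, map_smul]
  simp [mul_comm]

theorem sum_conv_antipode {ι : Type*} [Fintype ι] (b : Module.Basis ι k A)
    (f : A →ₗ[k] k) (q : A) :
    ∑ m, (toConv ((f ∘ₗ LinearMap.mulRight k (b m)) ∘ₗ antipode k) *
      toConv (b.coord m ∘ₗ LinearMap.mulRight k q)).ofConv = f q • counit := by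
  ext z
  have e : ∀ m, (toConv ((f ∘ₗ LinearMap.mulRight k (b m)) ∘ₗ antipode k) *
      toConv (b.coord m ∘ₗ LinearMap.mulRight k q)).ofConv z =
      ∑ i ∈ (ℛ k z).index, (f ∘ₗ LinearMap.mulRight k (b m)) (antipode k ((ℛ k z).left i)) *
        b.coord m ((ℛ k z).right i * q) := fun m => (ℛ k z).convMul_apply _ _
  rw [LinearMap.sum_apply]
  simp only [e]
  rw [Finset.sum_comm]
  simp only [← apply_mul_eq_sum, ← mul_assoc, ← map_sum,
    ← Finset.sum_mul, sum_antipode_mul_eq_algebraMap_counit, ← Algebra.smul_def, map_smul]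
  simp [mul_comm]

/-- A counterpart of `leftHit_comp_mulLeft` with the roles of `A` and its dual exchanged: the right
side is `∑ x₁a₁ f(S'(x₃)x₂a₂)`, and `S'(x₃)x₂` collapses. -/
theorem mulRight_rightHit {ι : Type*} [Fintype ι] (b : Module.Basis ι k A)
    (h : ∀ a, antipode k (S' a) = a) (h' : ∀ a, S' (antipode k a) = a)
    (f : A →ₗ[k] k) (a : A) :
    LinearMap.mulRight k (rightHit f a) = ∑ m, rightHit (b.coord m) ∘ₗ LinearMap.mulRight k a ∘ₗ
      rightHit ((f ∘ₗ LinearMap.mulRight k (b m)) ∘ₗ S') := by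
  ext x
  simp only [LinearMap.sum_apply, LinearMap.comp_apply, LinearMap.mulRight_apply,
    rightHit_mul_apply _ _ (ℛ k a)]
  rw [Finset.sum_comm]
  simp only [← Finset.sum_mul, ← LinearMap.comp_apply (rightHit _) (rightHit _), ← rightHit_mul,
    ← LinearMap.sum_apply, ← rightHit_sum, sum_conv_invAntipode b h h', rightHit_smul, rightHit_counit,
    LinearMap.smul_apply, LinearMap.id_apply]
  rw [rightHit_apply f (ℛ k a), Finset.mul_sum]
  simp

theorem mulRight_leftHit {ι : Type*} [Fintype ι] (b : Module.Basis ι k A)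
    (f : A →ₗ[k] k) (a : A) :
    LinearMap.mulRight k (leftHit f a) = ∑ m, leftHit (b.coord m) ∘ₗ LinearMap.mulRight k a ∘ₗ
      leftHit ((f ∘ₗ LinearMap.mulRight k (b m)) ∘ₗ antipode k) := by
  ext x
  simp only [LinearMap.sum_apply, LinearMap.comp_apply, LinearMap.mulRight_apply,
    leftHit_mul_apply _ _ (ℛ k a)]
  rw [Finset.sum_comm]
  simp only [← Finset.sum_mul, ← LinearMap.comp_apply (leftHit _) (leftHit _), ← leftHit_mul,
    ← LinearMap.sum_apply, ← leftHit_sum, sum_conv_antipode b, leftHit_smul, leftHit_counit,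
    LinearMap.smul_apply, LinearMap.id_apply]
  rw [leftHit_apply f (ℛ k a), Finset.mul_sum]
  simp

end InverseAntipode

/-! ### Integrals from twisted traces. -/

section Trace

variable {k A : Type*} [Field k] [Ring A] [HopfAlgebra k A] [FiniteDimensional k A]
  {S' T : A →ₗ[k] A}

/-- The element of `A` representing `f ↦ tr(leftHit f ∘ S²)` is a left integral. -/
theorem trace_leftHit_comp_mulLeft (h : ∀ a, antipode k (S' a) = a)
    (h' : ∀ a, S' (antipode k a) = a) (f : A →ₗ[k] k) (a : A) :
    LinearMap.trace k A (leftHit (f ∘ₗ LinearMap.mulLeft k a) ∘ₗ antipode k ∘ₗ antipode k) =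
      counit (R := k) a * LinearMap.trace k A (leftHit f ∘ₗ antipode k ∘ₗ antipode k) := by
  set r := ℛ k a
  -- After cyclic rotation, `S²` turns `S'(a₂)` into `S(a₂)`, so that `∑ a₁S(a₂)` yields the counit;
  -- this is why the trace must be twisted.
  have key : ∑ i ∈ r.index, leftHit f ∘ₗ LinearMap.mulLeft k (r.left i) ∘ₗ
      (antipode k ∘ₗ antipode k) ∘ₗ LinearMap.mulLeft k (S' (r.right i)) =
      counit (R := k) a • (leftHit f ∘ₗ antipode k ∘ₗ antipode k) := by
    ext x
    simp only [LinearMap.sum_apply, LinearMap.comp_apply, LinearMap.mulLeft_apply,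
      antipode_mul_antidistrib, h, ← mul_assoc, ← map_sum, ← Finset.sum_mul,
      sum_mul_antipode_eq_algebraMap_counit, ← Algebra.smul_def, map_smul,
      LinearMap.smul_apply]
  rw [← smul_eq_mul, ← map_smul, ← key, leftHit_comp_mulLeft h h' f r, sum_comp,
    map_sum, map_sum]
  refine Finset.sum_congr rfl fun i _ => ?_
  rw [LinearMap.comp_assoc, LinearMap.trace_comp_comm']
  rfl

/-- The element of `A` representing `f ↦ tr(leftHit f ∘ S⁻²)` is a right integral. -/
theorem trace_leftHit_comp_mulRight (h : ∀ a, antipode k (S' a) = a)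
    (h' : ∀ a, S' (antipode k a) = a) (f : A →ₗ[k] k) (a : A) :
    LinearMap.trace k A (leftHit (f ∘ₗ LinearMap.mulRight k a) ∘ₗ S' ∘ₗ S') =
      counit (R := k) a * LinearMap.trace k A (leftHit f ∘ₗ S' ∘ₗ S') := by
  set r := ℛ k a
  have key : ∑ i ∈ r.index, leftHit f ∘ₗ LinearMap.mulRight k (r.left i) ∘ₗ
      (S' ∘ₗ S') ∘ₗ LinearMap.mulRight k (antipode k (r.right i)) =
      counit (R := k) a • (leftHit f ∘ₗ S' ∘ₗ S') := by
    ext x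
    simp only [LinearMap.sum_apply, LinearMap.comp_apply, LinearMap.mulRight_apply,
      invAntipode_mul h h', h', mul_assoc, ← map_sum, ← Finset.mul_sum,
      sum_invAntipode_mul h h', ← Algebra.commutes, ← Algebra.smul_def, map_smul,
      LinearMap.smul_apply]
  rw [← smul_eq_mul, ← map_smul, ← key, leftHit_comp_mulRight f r, sum_comp,
    map_sum, map_sum]
  refine Finset.sum_congr rfl fun i _ => ?_
  rw [LinearMap.comp_assoc, LinearMap.trace_comp_comm']
  rfl

/-- The form `a ↦ tr(x ↦ T(x)a)` is a right integral on `A`, where `T` plays the role of `S²`. -/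
theorem trace_mulRight_rightHit (h : ∀ a, antipode k (S' a) = a)
    (h' : ∀ a, S' (antipode k a) = a)
    (hT : ∀ f : A →ₗ[k] k, rightHit f ∘ₗ T = T ∘ₗ rightHit (f ∘ₗ T))
    (hS : S' ∘ₗ T = antipode k) (f : A →ₗ[k] k) (a : A) :
    LinearMap.trace k A (LinearMap.mulRight k (rightHit f a) ∘ₗ T) =
      f 1 * LinearMap.trace k A (LinearMap.mulRight k a ∘ₗ T) := by
  have b := Module.finBasis k A
  -- Moving the hit past `T` replaces `S'` by `S' ∘ T = S`; the rotated sum is then the collapsing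
  -- one.
  have key : ∑ m, rightHit ((f ∘ₗ LinearMap.mulRight k (b m)) ∘ₗ antipode k) ∘ₗ
      rightHit (b.coord m) = f 1 • LinearMap.id := by
    have := congrArg rightHit (sum_conv_antipode b f 1)
    rw [rightHit_sum, rightHit_smul, rightHit_counit] at this
    simpa only [rightHit_mul, LinearMap.mulRight_one, LinearMap.comp_id] using this
  rw [mulRight_rightHit b h h', sum_comp, map_sum]
  have key2 := congrArg (fun F => LinearMap.trace k A (LinearMap.mulRight k a ∘ₗ T ∘ₗ F)) key
  simp only [LinearMap.comp_smul, LinearMap.comp_id, map_smul, smul_eq_mul, comp_sum,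
    map_sum] at key2
  rw [← key2]
  refine Finset.sum_congr rfl fun m _ => ?_
  rw [LinearMap.comp_assoc, LinearMap.trace_comp_comm', LinearMap.comp_assoc, LinearMap.comp_assoc,
    ← LinearMap.comp_assoc _ T, hT, LinearMap.comp_assoc _ S', hS]
  rfl

/-- The form `a ↦ tr(x ↦ T(x)a)` is a left integral on `A`, where `T` plays the role of `S⁻²`. -/
theorem trace_mulRight_leftHit (h : ∀ a, antipode k (S' a) = a)
    (h' : ∀ a, S' (antipode k a) = a)
    (hT : ∀ f : A →ₗ[k] k, leftHit f ∘ₗ T = T ∘ₗ leftHit (f ∘ₗ T))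
    (hS : antipode k ∘ₗ T = S') (f : A →ₗ[k] k) (a : A) :
    LinearMap.trace k A (LinearMap.mulRight k (leftHit f a) ∘ₗ T) =
      f 1 * LinearMap.trace k A (LinearMap.mulRight k a ∘ₗ T) := by
  have b := Module.finBasis k A
  have key : ∑ m, leftHit ((f ∘ₗ LinearMap.mulRight k (b m)) ∘ₗ S') ∘ₗ
      leftHit (b.coord m) = f 1 • LinearMap.id := by
    have := congrArg leftHit (sum_conv_invAntipode b h h' f 1)
    rw [leftHit_sum, leftHit_smul, leftHit_counit] at this
    simpa only [leftHit_mul, LinearMap.mulRight_one, LinearMap.comp_id] using this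
  rw [mulRight_leftHit b, sum_comp, map_sum]
  have key2 := congrArg (fun F => LinearMap.trace k A (LinearMap.mulRight k a ∘ₗ T ∘ₗ F)) key
  simp only [LinearMap.comp_smul, LinearMap.comp_id, map_smul, smul_eq_mul, comp_sum,
    map_sum] at key2
  rw [← key2]
  refine Finset.sum_congr rfl fun m _ => ?_
  rw [LinearMap.comp_assoc, LinearMap.trace_comp_comm', LinearMap.comp_assoc, LinearMap.comp_assoc,
    ← LinearMap.comp_assoc _ T, hT, LinearMap.comp_assoc _ (antipode k), hS]
  rfl

end Trace

/-! ### Dimensions as traces. -/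

section Dimension

variable {k V : Type*} [Field k] [AddCommGroup V] [Module k V] [FiniteDimensional k V]

theorem leftDim_apply_one (φ : Module.Dual k V ≃ₗ[k] Module.Dual k V) (ψ : V →ₗ[k] V)
    (h : φ.toLinearMap = ψ.dualMap) : leftDim φ 1 = LinearMap.trace k V ψ := by
  simp only [leftDim, LinearMap.comp_apply, coevaluation_apply_one, h, map_sum]
  classical
  rw [LinearMap.trace_eq_matrix_trace k (Module.Basis.ofVectorSpace k V), Matrix.trace]
  simp [LinearMap.toMatrix_apply]

theorem rightDim_apply_one (φ : Module.Dual k V ≃ₗ[k] Module.Dual k V) (ψ : V →ₗ[k] V)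
    (h : φ.symm.toLinearMap = ψ.dualMap) : rightDim φ 1 = LinearMap.trace k V ψ := by
  simp only [rightDim, LinearMap.comp_apply, coevaluation_apply_one, h, map_sum]
  classical
  rw [LinearMap.trace_eq_matrix_trace k (Module.Basis.ofVectorSpace k V), Matrix.trace]
  simp [LinearMap.toMatrix_apply]

theorem trace_ne_zero_of_leftDim_ne_zero (φ : Module.Dual k V ≃ₗ[k] Module.Dual k V)
    (ψ : V →ₗ[k] V) (h : φ.toLinearMap = ψ.dualMap) (hφ : leftDim φ ≠ 0) :
    LinearMap.trace k V ψ ≠ 0 := by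
  rw [← leftDim_apply_one φ ψ h]
  exact fun h0 => hφ (LinearMap.ext_ring h0)

theorem trace_ne_zero_of_rightDim_ne_zero (φ : Module.Dual k V ≃ₗ[k] Module.Dual k V)
    (ψ : V →ₗ[k] V) (h : φ.symm.toLinearMap = ψ.dualMap) (hφ : rightDim φ ≠ 0) :
    LinearMap.trace k V ψ ≠ 0 := by
  rw [← rightDim_apply_one φ ψ h]
  exact fun h0 => hφ (LinearMap.ext_ring h0)

end Dimension

/-! ### Group-like elements and hits. -/

section GroupLike

variable {k A : Type*} [Field k] [Ring A] [HopfAlgebra k A]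

theorem leftHit_groupLike (f : A →ₗ[k] k) {g : A} (hg : IsGroupLikeElem k g) :
    leftHit f g = f g • g := by
  simp [leftHit, hg.comul_eq_tmul_self]

theorem rightHit_groupLike (f : A →ₗ[k] k) {g : A} (hg : IsGroupLikeElem k g) :
    rightHit f g = f g • g := by
  simp [rightHit, RightComodule.act, RightComodule.regular, hg.comul_eq_tmul_self]

/-- For group-like `u`, `v` the map `x ↦ uxv` respects comultiplication. This supplies the
hypothesis `hT` of the trace lemmas. -/
theorem leftHit_comp_mulLeft_mulRight (f : A →ₗ[k] k) {u v : A} (hu : IsGroupLikeElem k u)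
    (hv : IsGroupLikeElem k v) :
    leftHit f ∘ₗ (LinearMap.mulLeft k u ∘ₗ LinearMap.mulRight k v) =
      (LinearMap.mulLeft k u ∘ₗ LinearMap.mulRight k v) ∘ₗ
        leftHit (f ∘ₗ LinearMap.mulLeft k u ∘ₗ LinearMap.mulRight k v) := by
  ext x
  simp only [LinearMap.comp_apply, leftHit_apply _ (ℛ k x)]
  simp [leftHit, hu.comul_eq_tmul_self, hv.comul_eq_tmul_self, ← (ℛ k x).eq, Finset.mul_sum,
    Finset.sum_mul]

theorem rightHit_comp_mulLeft_mulRight (f : A →ₗ[k] k) {u v : A} (hu : IsGroupLikeElem k u)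
    (hv : IsGroupLikeElem k v) :
    rightHit f ∘ₗ (LinearMap.mulLeft k u ∘ₗ LinearMap.mulRight k v) =
      (LinearMap.mulLeft k u ∘ₗ LinearMap.mulRight k v) ∘ₗ
        rightHit (f ∘ₗ LinearMap.mulLeft k u ∘ₗ LinearMap.mulRight k v) := by
  ext x
  simp only [LinearMap.comp_apply, rightHit_apply _ (ℛ k x)]
  simp [rightHit, RightComodule.act, RightComodule.regular,
    hu.comul_eq_tmul_self, hv.comul_eq_tmul_self, ← (ℛ k x).eq, Finset.mul_sum, Finset.sum_mul]

theorem eq_of_forall_dual_mul_eq {V : Type*} [AddCommGroup V] [Module k V] {u v : V} {c : k}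
    (hc : c ≠ 0) (h : ∀ f : V →ₗ[k] k, f u * c = f v * c) : u = v := by
  rw [← sub_eq_zero, ← Module.forall_dual_apply_eq_zero_iff k]
  intro f
  rw [map_sub, mul_right_cancel₀ hc (h f), sub_self]

end GroupLike

/-! ### Sovereign elements. -/

section Sovereign

variable {k A : Type*} [Field k] [Ring A] [HopfAlgebra k A] [FiniteDimensional k A]

theorem SovereignElement.elem_eq_one (Φ : SovereignElement k A)
    (hΦ : Φ.leftDim A ≠ 0 ∨ Φ.rightDim A ≠ 0) : (Φ.elem : A) = 1 := by
  set e := LinearEquiv.ofBijective (antipode k : A →ₗ[k] A) Φ.bijective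
  obtain ⟨g, hg⟩ : ∃ g : A, g = Φ.elem := ⟨_, rfl⟩
  obtain ⟨g', hg'⟩ : ∃ g : A, g = (Φ.elem⁻¹ : GroupLike k A) := ⟨_, rfl⟩
  have gl : IsGroupLikeElem k g := hg ▸ Φ.elem.2
  have gl' : IsGroupLikeElem k g' := hg' ▸ (Φ.elem⁻¹).2
  have gg' : g * g' = 1 := by rw [hg, hg']; simp [Φ.elem.2]
  have g'g : g' * g = 1 := by rw [hg, hg']; simp [Φ.elem.2]
  have Sg : antipode k g = g' := by rw [hg, hg']; rfl
  have Sg' : antipode k g' = g := by rw [← Sg, gl.antipode_antipode]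
  have h : ∀ a, antipode k ((e.symm : A →ₗ[k] A) a) = a := e.apply_symm_apply
  have h' : ∀ a, (e.symm : A →ₗ[k] A) (antipode k a) = a := e.symm_apply_apply
  have hinv : ∀ a, (e.symm : A →ₗ[k] A) a = g * antipode k a * g' := by
    intro a
    rw [hg, hg']
    exact Φ.inv_antipode a
  rw [← hg]
  rcases hΦ with hΦ | hΦ
  · have ht := trace_ne_zero_of_leftDim_ne_zero (Φ.iso A) (LinearMap.mulLeft k g) (by
      ext f x
      simp [SovereignElement.iso, leftDualSMul, hg, Φ.elem.2]) hΦ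
    refine eq_of_forall_dual_mul_eq ht fun f => ?_
    -- Here `T = S⁻²` is conjugation by `g`. Following it by right multiplication by `g` leaves left
    -- multiplication by `g`, whose trace is the left dimension.
    have := trace_mulRight_leftHit h h' (T := LinearMap.mulLeft k g ∘ₗ LinearMap.mulRight k g')
      (fun f => leftHit_comp_mulLeft_mulRight f gl gl') (by
        ext x
        rw [hinv]
        simp [antipode_mul_antidistrib, Sg, Sg', mul_assoc]) f g
    have e2 : LinearMap.mulRight k g ∘ₗ LinearMap.mulLeft k g ∘ₗ LinearMap.mulRight k g' =
        LinearMap.mulLeft k g := by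
      ext x
      simp [mul_assoc, g'g]
    have e3 : LinearMap.mulRight k (f g • g) = f g • LinearMap.mulRight k g := by
      ext x
      simp
    rwa [leftHit_groupLike f gl, e3, LinearMap.smul_comp, map_smul, e2, smul_eq_mul] at this
  · have ht := trace_ne_zero_of_rightDim_ne_zero (Φ.iso A) (LinearMap.mulLeft k g') (by
      ext f x
      simp [SovereignElement.iso, leftDualSMul, hg', Φ.elem.2]) hΦ
    suffices g' = 1 by rw [← gg', this, mul_one]
    refine eq_of_forall_dual_mul_eq ht fun f => ?_
    -- The mirror image, with `T = S²` and `g' = g⁻¹`.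
    have := trace_mulRight_rightHit h h' (T := LinearMap.mulLeft k g' ∘ₗ LinearMap.mulRight k g)
      (fun f => rightHit_comp_mulLeft_mulRight f gl' gl) (by
        ext x
        rw [LinearMap.comp_apply, hinv]
        simp [antipode_mul_antidistrib, Sg, Sg', ← mul_assoc, gg']
        simp [mul_assoc, gg']) f g'
    have e2 : LinearMap.mulRight k g' ∘ₗ LinearMap.mulLeft k g' ∘ₗ LinearMap.mulRight k g =
        LinearMap.mulLeft k g' := by
      ext x
      simp [mul_assoc, gg']
    have e3 : LinearMap.mulRight k (f g' • g') = f g' • LinearMap.mulRight k g' := by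
      ext x
      simp
    rwa [rightHit_groupLike f gl', e3, LinearMap.smul_comp, map_smul, e2, smul_eq_mul] at this

theorem SovereignElement.antipode_comp_antipode (Φ : SovereignElement k A)
    (hΦ : Φ.leftDim A ≠ 0 ∨ Φ.rightDim A ≠ 0) :
    antipode k (A := A) ∘ₗ antipode k = LinearMap.id := by
  have h1 := Φ.elem_eq_one hΦ
  ext a
  have := Φ.inv_antipode a
  rw [GroupLike.val_inv, h1, antipode_one, one_mul, mul_one] at this
  rw [LinearMap.comp_apply, ← this]
  exact (LinearEquiv.ofBijective (antipode k : A →ₗ[k] A) Φ.bijective).apply_symm_apply a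

end Sovereign

/-! ### Sovereign characters. -/

section Cosovereign

variable {k A : Type*} [Field k] [Ring A] [HopfAlgebra k A]

/-- With its right-hand version, this turns `S⁻¹ = Φ * S * Φ⁻¹` into `S` composed with two commuting
hits. -/
theorem conv_linearMap_left (f : A →ₗ[k] k) (F : A →ₗ[k] A) :
    toConv (Algebra.linearMap k A ∘ₗ f) * toConv F = toConv (F ∘ₗ leftHit f) := by
  ext x
  rw [(ℛ k x).convMul_apply]
  simp only [LinearMap.comp_apply, leftHit_apply f (ℛ k x), map_sum, map_smul]
  simp [Algebra.smul_def]

theorem conv_linearMap_right (f : A →ₗ[k] k) (F : A →ₗ[k] A) :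
    toConv F * toConv (Algebra.linearMap k A ∘ₗ f) = toConv (F ∘ₗ rightHit f) := by
  ext x
  rw [(ℛ k x).convMul_apply]
  simp only [LinearMap.comp_apply, rightHit_apply f (ℛ k x), map_sum, map_smul]
  simp [Algebra.smul_def, Algebra.commutes]

theorem charInv_charInv (φ : A →ₐ[k] k) : charInv (charInv φ) = φ := by
  apply AlgHom.toLinearMap_injective
  apply WithConv.toConv_injective
  exact left_inv_eq_right_inv (charInv_mul (charInv φ)) (charInv_mul φ)

theorem leftHit_comp_leftHit_charInv (φ : A →ₐ[k] k) :
    leftHit φ.toLinearMap ∘ₗ leftHit (charInv φ).toLinearMap = LinearMap.id := by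
  rw [← leftHit_mul, charInv_mul]
  exact leftHit_counit

theorem rightHit_comp_rightHit_charInv (φ : A →ₐ[k] k) :
    rightHit φ.toLinearMap ∘ₗ rightHit (charInv φ).toLinearMap = LinearMap.id := by
  rw [← rightHit_mul, mul_charInv]
  exact rightHit_counit

theorem SovereignCharacter.invAntipode_eq (Φ : SovereignCharacter k A) (x : A) :
    (LinearEquiv.ofBijective (antipode k : A →ₗ[k] A) Φ.bijective).symm x =
      antipode k (leftHit Φ.char.toLinearMap (rightHit (charInv Φ.char).toLinearMap x)) := by
  have h := Φ.inv_antipode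
  rw [conv_linearMap_left, conv_linearMap_right] at h
  exact LinearMap.congr_fun (WithConv.toConv_injective h) x

variable [FiniteDimensional k A]

theorem SovereignCharacter.char_eq_counit (Φ : SovereignCharacter k A)
    (hΦ : Φ.leftDim (RightComodule.regular k A) ≠ 0 ∨
      Φ.rightDim (RightComodule.regular k A) ≠ 0) :
    Φ.char.toLinearMap = counit := by
  set e := LinearEquiv.ofBijective (antipode k : A →ₗ[k] A) Φ.bijective
  set φ := Φ.char
  have h : ∀ a, antipode k ((e.symm : A →ₗ[k] A) a) = a := e.apply_symm_apply
  have h' : ∀ a, (e.symm : A →ₗ[k] A) (antipode k a) = a := e.symm_apply_apply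
  have hinv : ∀ a, (e.symm : A →ₗ[k] A) a =
    antipode k (leftHit φ.toLinearMap (rightHit (charInv φ).toLinearMap a)) := Φ.invAntipode_eq
  have hl := fun a => LinearMap.congr_fun (leftHit_comp_leftHit_charInv φ) a
  have hl' := fun a => LinearMap.congr_fun (leftHit_comp_leftHit_charInv (charInv φ)) a
  have hr := fun a => LinearMap.congr_fun (rightHit_comp_rightHit_charInv φ) a
  have hr' := fun a => LinearMap.congr_fun (rightHit_comp_rightHit_charInv (charInv φ)) a
  rw [charInv_charInv] at hl' hr'
  simp only [LinearMap.comp_apply, LinearMap.id_apply] at hl hl' hr hr'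
  have hS : ∀ a, antipode k (antipode k a) =
      leftHit (charInv φ).toLinearMap (rightHit φ.toLinearMap a) := by
    intro a
    -- The argument is chosen so that the hits in the formula for `S⁻¹` cancel it back to `a`.
    have := h (rightHit φ.toLinearMap (leftHit (charInv φ).toLinearMap a))
    rwa [hinv, hr', hl, rightHit_leftHit] at this
  rcases hΦ with hΦ | hΦ
  · have ht := trace_ne_zero_of_leftDim_ne_zero (Φ.iso (RightComodule.regular k A))
      (rightHit φ.toLinearMap) (by
        change (RightComodule.regular k A).leftDualAct (charInv φ).toLinearMap = _
        rw [RightComodule.leftDualAct_eq]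
        change (rightHit (charInv (charInv φ)).toLinearMap).dualMap = _
        rw [charInv_charInv]) hΦ
    -- At `φ` the integral `f ↦ tr(leftHit f ∘ S²)` therefore equals the left dimension.
    have e1 : leftHit φ.toLinearMap ∘ₗ antipode k ∘ₗ antipode k = rightHit φ.toLinearMap := by
      ext a
      simp [hS, hl]
    ext a
    have := trace_leftHit_comp_mulLeft h h' φ.toLinearMap a
    -- Translating `φ` by `a` scales it by `φ(a)`, whereas the integral property scales its value by
    -- `ε(a)`.
    have e2 : φ.toLinearMap ∘ₗ LinearMap.mulLeft k a = φ a • φ.toLinearMap := by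
      ext b
      simp
    rw [e2, leftHit_smul, LinearMap.smul_comp, map_smul, e1, smul_eq_mul] at this
    exact mul_right_cancel₀ ht this
  · have ht := trace_ne_zero_of_rightDim_ne_zero (Φ.iso (RightComodule.regular k A))
      (rightHit (charInv φ).toLinearMap) (by
        change (RightComodule.regular k A).leftDualAct φ.toLinearMap = _
        rw [RightComodule.leftDualAct_eq]
        rfl) hΦ
    have hS' : ∀ a, (e.symm : A →ₗ[k] A) ((e.symm : A →ₗ[k] A) a) =
        leftHit φ.toLinearMap (rightHit (charInv φ).toLinearMap a) := by
      intro a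
      rw [hinv a, h']
    have e1 : leftHit (charInv φ).toLinearMap ∘ₗ (e.symm : A →ₗ[k] A) ∘ₗ (e.symm : A →ₗ[k] A) =
        rightHit (charInv φ).toLinearMap := by
      ext a
      simp only [LinearMap.comp_apply, hS', hl']
    have key : (charInv φ).toLinearMap = counit := by
      ext a
      have := trace_leftHit_comp_mulRight h h' (charInv φ).toLinearMap a
      have e2 : (charInv φ).toLinearMap ∘ₗ LinearMap.mulRight k a =
          charInv φ a • (charInv φ).toLinearMap := by
        ext b
        simp [mul_comm]
      rw [e2, leftHit_smul, LinearMap.smul_comp, map_smul, e1, smul_eq_mul] at this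
      exact mul_right_cancel₀ ht this
    rw [← charInv_charInv φ]
    change (charInv φ).toLinearMap ∘ₗ antipode k = _
    rw [key, counit_comp_antipode]

theorem SovereignCharacter.antipode_comp_antipode (Φ : SovereignCharacter k A)
    (hΦ : Φ.leftDim (RightComodule.regular k A) ≠ 0 ∨
      Φ.rightDim (RightComodule.regular k A) ≠ 0) :
    antipode k (A := A) ∘ₗ antipode k = LinearMap.id := by
  have h1 := Φ.char_eq_counit hΦ
  have h2 : (charInv Φ.char).toLinearMap = counit := by
    change Φ.char.toLinearMap ∘ₗ antipode k = _
    rw [h1, counit_comp_antipode]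
  ext a
  have := Φ.invAntipode_eq a
  rw [h1, h2, leftHit_counit, rightHit_counit] at this
  rw [LinearMap.comp_apply]
  change _ = antipode k a at this
  rw [← this]
  exact (LinearEquiv.ofBijective (antipode k : A →ₗ[k] A) Φ.bijective).apply_symm_apply a

end Cosovereign

/-! ### Maschke averaging. -/

section Casimir

/-- Maschke's theorem for an algebra with a separability idempotent `∑ xᵢ ⊗ yᵢ`. -/
theorem isSemisimpleModule_of_casimir {k B M ι : Type*} [Field k] [Ring B] [Algebra k B]
    [AddCommGroup M] [Module k M] [Module B M] [IsScalarTower k B M] (s : Finset ι)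
    (x y : ι → B)
    (hxy : ∀ b : B, ∑ i ∈ s, (b * x i) ⊗ₜ[k] y i = ∑ i ∈ s, x i ⊗ₜ[k] (y i * b))
    (h1 : ∑ i ∈ s, x i * y i = 1) : IsSemisimpleModule B M := by
  rw [isSemisimpleModule_iff]
  refine ⟨fun N => ?_⟩
  obtain ⟨p, hp⟩ := LinearMap.exists_leftInverse_of_injective
    (N.restrictScalars k).subtype (by simp)
  let q : M →ₗ[k] N := p
  have hq : ∀ n : N, q n = n := fun n => LinearMap.congr_fun hp n
  let avg : M → B ⊗[k] B →ₗ[k] N := fun v => TensorProduct.lift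
    (LinearMap.mk₂ k (fun u w => u • q (w • v))
      (fun _ _ _ => add_smul _ _ _) (fun _ _ _ => smul_assoc _ _ _)
      (fun _ _ _ => by rw [add_smul, map_add, smul_add])
      (fun c u w => by rw [smul_assoc, map_smul, smul_comm]))
  have havg : ∀ v u w, avg v (u ⊗ₜ w) = u • q (w • v) := fun _ _ _ => rfl
  -- The average `∑ xᵢ q(yᵢ v)` of a `k`-linear projection; the Casimir identity makes it
  -- `B`-linear.
  let P : M →ₗ[B] N :=
    { toFun := fun v => ∑ i ∈ s, x i • q (y i • v)
      map_add' := fun v w => by simp [smul_add, Finset.sum_add_distrib]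
      map_smul' := fun b v => by
        have := congrArg (avg v) (hxy b)
        simp only [map_sum, havg] at this
        simp only [RingHom.id_apply, Finset.smul_sum, smul_smul, this] }
  refine ⟨LinearMap.ker P, LinearMap.isCompl_of_proj (f := P) fun n => ?_⟩
  change ∑ i ∈ s, x i • q (y i • (n : M)) = n
  have : ∀ i, q (y i • (n : M)) = y i • n := fun i => hq (y i • n)
  simp only [this, smul_smul, ← Finset.sum_smul, h1, one_smul]

end Casimir

/-! ### Semisimplicity from an integral in `A`. -/

section Convolution

variable (k A : Type*) [Field k] [Ring A] [HopfAlgebra k A]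

/-- The map `a ↦ a ⊗ 1`. -/
def inLeft : A →ₗ[k] A ⊗[k] A :=
  (Algebra.TensorProduct.includeLeft : A →ₐ[k] A ⊗[k] A).toLinearMap

/-- The map `a ↦ 1 ⊗ a`. -/
def inRight : A →ₗ[k] A ⊗[k] A :=
  (Algebra.TensorProduct.includeRight : A →ₐ[k] A ⊗[k] A).toLinearMap

variable {k A}

theorem comp_conv_one {C : Type*} [Semiring C] [Algebra k C] (h : A →ₐ[k] C)
    {f g : A →ₗ[k] A} (hfg : toConv f * toConv g = 1) :
    toConv (h.toLinearMap ∘ₗ f) * toConv (h.toLinearMap ∘ₗ g) = 1 := by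
  have := LinearMap.algHom_comp_convMul_distrib h (toConv f) (toConv g)
  rw [hfg] at this
  apply WithConv.ofConv_injective
  refine this.symm.trans ?_
  ext a
  simp

theorem inLeft_conv_inRight : toConv (inLeft k A) * toConv (inRight k A) = toConv comul := by
  ext a
  rw [(ℛ k a).convMul_apply]
  simp [inLeft, inRight, (ℛ k a).eq]

theorem inLeft_conv_inRight_antipode :
    toConv (inLeft k A) * toConv (inRight k A ∘ₗ antipode k) =
      toConv ((antipode k).lTensor A ∘ₗ comul) := by
  ext a
  rw [(ℛ k a).convMul_apply]
  simp [inLeft, inRight, ← (ℛ k a).eq]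

theorem antipode_conv_inRight :
    toConv (inRight k A ∘ₗ antipode k) * toConv (inRight k A) = 1 := by
  have := comp_conv_one (Algebra.TensorProduct.includeRight : A →ₐ[k] A ⊗[k] A)
    (LinearMap.antipode_mul_id (R := k) (C := A))
  rwa [LinearMap.comp_id] at this

theorem inRight_conv_antipode :
    toConv (inRight k A) * toConv (inRight k A ∘ₗ antipode k) = 1 := by
  have := comp_conv_one (Algebra.TensorProduct.includeRight : A →ₐ[k] A ⊗[k] A)
    (LinearMap.id_mul_antipode (R := k) (C := A))
  rwa [LinearMap.comp_id] at this

theorem comul_antipode_conv_comul :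
    toConv (comul ∘ₗ antipode k : A →ₗ[k] A ⊗[k] A) * toConv comul = 1 := by
  have := comp_conv_one (Bialgebra.comulAlgHom k A)
    (LinearMap.antipode_mul_id (R := k) (C := A))
  rwa [LinearMap.comp_id] at this

/-- `∑ Δ(S(a₁))(a₂ ⊗ 1) = 1 ⊗ S(a)`. -/
theorem comul_antipode_conv_inLeft :
    toConv (comul ∘ₗ antipode k : A →ₗ[k] A ⊗[k] A) * toConv (inLeft k A) =
      toConv (inRight k A ∘ₗ antipode k) := by
  refine left_inv_eq_right_inv ?_ (inRight_conv_antipode (k := k) (A := A))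
  rw [mul_assoc, inLeft_conv_inRight, comul_antipode_conv_comul]

/-- `∑ (a₁ ⊗ S(a₂))(1 ⊗ a₃) = a ⊗ 1`. -/
theorem lTensor_antipode_comul_conv_inRight :
    toConv ((antipode k).lTensor A ∘ₗ comul) * toConv (inRight k A) = toConv (inLeft k A) := by
  rw [← inLeft_conv_inRight_antipode, mul_assoc, antipode_conv_inRight, mul_one]

/-- `(1 ⊗ S) ∘ Δ` is multiplicative into `A ⊗ Aᵒᵖ`; hence the factors of `z` stand on opposite
sides. -/
theorem lTensor_antipode_comul_mul {ι : Type*} (u : A) {z : A} (r : Repr k z ι) :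
    (antipode k).lTensor A (comul (u * z)) = ∑ i ∈ r.index,
      ((1 : A) ⊗ₜ[k] antipode k (r.right i)) * (antipode k).lTensor A (comul u) *
        (r.left i ⊗ₜ 1) := by
  rw [Bialgebra.comul_mul, ← r.eq]
  generalize comul (R := k) u = t
  induction t with
  | zero => simp
  | add x y hx hy => simp only [map_add, add_mul, mul_add, hx, hy, Finset.sum_add_distrib]
  | tmul v w => simp [Finset.mul_sum, antipode_mul_antidistrib]

/-- A Hopf algebra with a left integral `Λ` such that `ε(Λ) ≠ 0` is semisimple. -/
theorem isSemisimpleRing_of_integral (Λ : A) (hΛ : ∀ a, a * Λ = counit (R := k) a • Λ)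
    (h0 : counit (R := k) Λ ≠ 0) : IsSemisimpleRing A := by
  set r := ℛ k Λ
  -- The separability idempotent is `ε(Λ)⁻¹ ∑ Λ₁ ⊗ S(Λ₂)`.
  refine isSemisimpleModule_of_casimir (k := k) (M := A) r.index
    (fun i => (counit (R := k) Λ)⁻¹ • r.left i) (fun i => antipode k (r.right i))
    (fun a => ?_) ?_
  · suffices H : ∑ i ∈ r.index, (a * r.left i) ⊗ₜ[k] antipode k (r.right i) =
        ∑ i ∈ r.index, r.left i ⊗ₜ[k] (antipode k (r.right i) * a) by
      simpa only [mul_smul_comm, ← TensorProduct.smul_tmul', ← Finset.smul_sum] using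
        congrArg ((counit (R := k) Λ)⁻¹ • ·) H
    have h1 : (toConv ((antipode k).lTensor A ∘ₗ comul) * toConv (inRight k A)) a =
        a ⊗ₜ[k] 1 := by
      rw [lTensor_antipode_comul_conv_inRight]
      rfl
    set ra := ℛ k a
    rw [ra.convMul_apply] at h1
    -- The sum `∑ (1 ⊗ S)Δ(a₁Λ)(1 ⊗ a₂)` is computed twice: by expanding the product here, and by
    -- `a₁Λ = ε(a₁)Λ` below.
    have h2 : ∑ j ∈ ra.index, (antipode k).lTensor A (comul (ra.left j * Λ)) *
        ((1 : A) ⊗ₜ[k] ra.right j) = ∑ i ∈ r.index, (a * r.left i) ⊗ₜ[k] antipode k (r.right i) := by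
      simp only [lTensor_antipode_comul_mul _ r, Finset.sum_mul]
      rw [Finset.sum_comm]
      refine Finset.sum_congr rfl fun i _ => ?_
      have := congrArg (fun t => ((1 : A) ⊗ₜ[k] antipode k (r.right i)) * t * (r.left i ⊗ₜ 1)) h1
      simp only [Finset.mul_sum, Finset.sum_mul, Algebra.TensorProduct.tmul_mul_tmul,
        one_mul, mul_one] at this
      rw [← this]
      refine Finset.sum_congr rfl fun j _ => ?_
      simp [inRight, mul_assoc]
    rw [← h2]
    have h3 : ∑ j ∈ ra.index, counit (R := k) (ra.left j) • ra.right j = a := sum_counit_smul ra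
    simp only [hΛ, map_smul, smul_mul_assoc]
    have h4 : ∀ j, counit (R := k) (ra.left j) • ((antipode k).lTensor A (comul Λ) *
        ((1 : A) ⊗ₜ[k] ra.right j)) = (antipode k).lTensor A (comul Λ) *
        ((1 : A) ⊗ₜ[k] (counit (R := k) (ra.left j) • ra.right j)) := by
      intro j
      rw [TensorProduct.tmul_smul, mul_smul_comm]
    simp only [h4, ← Finset.mul_sum, ← TensorProduct.tmul_sum, h3]
    rw [← r.eq]
    simp [Finset.sum_mul]
  · simp only [smul_mul_assoc, ← Finset.smul_sum, sum_mul_antipode_eq_algebraMap_counit,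
      Algebra.algebraMap_eq_smul_one, smul_smul, inv_mul_cancel₀ h0, one_smul]

end Convolution

/-! ### Subcoalgebras and the module over the dual algebra. -/

section DualAction

variable (k A : Type*) [Field k] [AddCommGroup A] [Module k A] [Coalgebra k A]

/-- The convolution algebra of linear forms acts on `A` by the operators `rightHit`. -/
def rightHitHom : WithConv (A →ₗ[k] k) →+* Module.End k A where
  toFun f := rightHit f.ofConv
  map_one' := rightHit_counit
  map_mul' f g := rightHit_mul f.ofConv g.ofConv
  map_zero' := by simpa using rightHit_smul (0 : k) (0 : A →ₗ[k] k)
  map_add' f g := by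
    ext x
    simp [rightHit_apply _ (ℛ k x), add_smul, Finset.sum_add_distrib]

/-- The coalgebra `A` as a left module over its convolution algebra of linear forms. -/
abbrev dualModule : Module (WithConv (A →ₗ[k] k)) A := Module.compHom A (rightHitHom k A)

variable {k A}

theorem isScalarTower_dualModule :
    letI := dualModule k A
    IsScalarTower k (WithConv (A →ₗ[k] k)) A :=
  letI := dualModule k A
  ⟨fun c f a => LinearMap.congr_fun (rightHit_smul c f.ofConv) a⟩

variable {ι : Type*} [Fintype ι]

theorem comul_eq_sum_rightHit (b : Module.Basis ι k A) (a : A) :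
    comul (R := k) a = ∑ i, rightHit (b.coord i) a ⊗ₜ[k] b i := by
  have h : ∀ t : A ⊗[k] A,
      t = ∑ i, TensorProduct.rid k A ((b.coord i).lTensor A t) ⊗ₜ[k] b i := by
    intro t
    induction t with
    | zero => simp
    | add x y hx hy =>
      simp only [map_add, TensorProduct.add_tmul, Finset.sum_add_distrib, ← hx, ← hy]
    | tmul u v =>
      conv_lhs => rw [← b.sum_repr v, TensorProduct.tmul_sum]
      simp [TensorProduct.smul_tmul']
  exact h _

theorem comul_eq_sum_leftHit (b : Module.Basis ι k A) (a : A) :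
    comul (R := k) a = ∑ i, b i ⊗ₜ[k] leftHit (b.coord i) a := by
  have h : ∀ t : A ⊗[k] A,
      t = ∑ i, b i ⊗ₜ[k] TensorProduct.lid k A ((b.coord i).rTensor A t) := by
    intro t
    induction t with
    | zero => simp
    | add x y hx hy =>
      simp only [map_add, TensorProduct.tmul_add, Finset.sum_add_distrib, ← hx, ← hy]
    | tmul u v =>
      conv_lhs => rw [← b.sum_repr u, TensorProduct.sum_tmul]
      simp [TensorProduct.smul_tmul']
  exact h _

theorem IsSubcoalgebra.rightHit_mem {D : Submodule k A} (hD : IsSubcoalgebra D)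
    (f : A →ₗ[k] k) {a : A} (ha : a ∈ D) : rightHit f a ∈ D := by
  have h : ∀ t : D ⊗[k] D,
      TensorProduct.rid k A (f.lTensor A (TensorProduct.map D.subtype D.subtype t)) ∈ D := by
    intro t
    induction t with
    | zero => simp
    | add x y hx hy => simpa only [map_add] using D.add_mem hx hy
    | tmul u v => simpa using D.smul_mem _ u.2
  obtain ⟨t, ht⟩ := hD a ha
  have := h t
  rwa [ht] at this

theorem IsSubcoalgebra.leftHit_mem {D : Submodule k A} (hD : IsSubcoalgebra D)
    (f : A →ₗ[k] k) {a : A} (ha : a ∈ D) : leftHit f a ∈ D := by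
  have h : ∀ t : D ⊗[k] D,
      TensorProduct.lid k A (f.rTensor A (TensorProduct.map D.subtype D.subtype t)) ∈ D := by
    intro t
    induction t with
    | zero => simp
    | add x y hx hy => simpa only [map_add] using D.add_mem hx hy
    | tmul u v => simpa using D.smul_mem _ v.2
  obtain ⟨t, ht⟩ := hD a ha
  have := h t
  rwa [ht] at this

variable [FiniteDimensional k A]

/-- The two stabilities put `Δ(D)` in `D ⊗ A` and in `A ⊗ D`, whose intersection is `D ⊗ D`; a
linear projection onto `D` makes this explicit. -/
theorem isSubcoalgebra_of_hit_mem {D : Submodule k A}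
    (hr : ∀ (f : A →ₗ[k] k), ∀ a ∈ D, rightHit f a ∈ D)
    (hl : ∀ (f : A →ₗ[k] k), ∀ a ∈ D, leftHit f a ∈ D) : IsSubcoalgebra D := by
  intro a ha
  have b := Module.finBasis k A
  obtain ⟨p, hp⟩ := LinearMap.exists_leftInverse_of_injective D.subtype (by simp)
  have hp' : ∀ x ∈ D, (p x : A) = x := fun x hx =>
    congrArg Subtype.val (LinearMap.congr_fun hp ⟨x, hx⟩)
  have h1 : (D.subtype ∘ₗ p).rTensor A (comul (R := k) a) = comul a := by
    rw [comul_eq_sum_rightHit b, map_sum]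
    refine Finset.sum_congr rfl fun i _ => ?_
    simp [hp' _ (hr _ a ha)]
  have h2 : (D.subtype ∘ₗ p).lTensor A (comul (R := k) a) = comul a := by
    rw [comul_eq_sum_leftHit b, map_sum]
    refine Finset.sum_congr rfl fun i _ => ?_
    simp [hp' _ (hl _ a ha)]
  refine ⟨TensorProduct.map p p (comul a), ?_⟩
  rw [← LinearMap.comp_apply, ← TensorProduct.map_comp]
  conv_rhs => rw [← h1, ← h2]
  rw [← LinearMap.comp_apply (LinearMap.rTensor A _), LinearMap.rTensor_comp_lTensor]

/-- An endomorphism of the right comodule `A` is of the form `leftHit f`. -/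
theorem eq_leftHit_of_commute (F : A →ₗ[k] A)
    (hF : ∀ (f : A →ₗ[k] k) (a : A), F (rightHit f a) = rightHit f (F a)) :
    F = leftHit (counit ∘ₗ F) := by
  have b := Module.finBasis k A
  ext a
  have h1 : comul (R := k) (F a) = F.rTensor A (comul a) := by
    rw [comul_eq_sum_rightHit b, comul_eq_sum_rightHit b, map_sum]
    exact Finset.sum_congr rfl fun i _ => by simp [hF]
  have h2 := LinearMap.congr_fun (leftHit_counit (k := k) (A := A)) (F a)
  change TensorProduct.lid k A (counit.rTensor A (comul (F a))) = F a at h2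
  rw [h1] at h2
  rw [leftHit, LinearMap.rTensor_comp]
  exact h2.symm

/-- A finite-dimensional coalgebra that is semisimple as a module over the algebra of linear forms
is cosemisimple. -/
theorem isCosemisimple_of_isSemisimpleModule
    (h : letI := dualModule k A; IsSemisimpleModule (WithConv (A →ₗ[k] k)) A) :
    IsCosemisimple k A := by
  let := dualModule k A
  have := isScalarTower_dualModule (k := k) (A := A)
  have : IsSemisimpleModule (WithConv (A →ₗ[k] k)) A := h
  -- Subcoalgebras are exactly the fully invariant submodules, since the module endomorphisms of `A`
  -- are exactly the operators `leftHit f`.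
  have sub_of_inv : ∀ N : Submodule (WithConv (A →ₗ[k] k)) A, N.IsFullyInvariant →
      IsSubcoalgebra (N.restrictScalars k) := by
    intro N hN
    refine isSubcoalgebra_of_hit_mem (fun f a ha => N.smul_mem (toConv f) ha) fun f a ha => ?_
    let F : A →ₗ[WithConv (A →ₗ[k] k)] A :=
      { toFun := leftHit f
        map_add' := map_add _
        map_smul' := fun g x => (rightHit_leftHit g.ofConv f x).symm }
    exact hN F ha
  let lift : (D : Submodule k A) → (∀ (f : A →ₗ[k] k), ∀ a ∈ D, rightHit f a ∈ D) →
      Submodule (WithConv (A →ₗ[k] k)) A := fun D hD =>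
    { carrier := D
      add_mem' := D.add_mem
      zero_mem' := D.zero_mem
      smul_mem' := fun f a ha => hD f.ofConv a ha }
  have inv_of_sub : ∀ (D : Submodule k A) (hD : IsSubcoalgebra D),
      (lift D fun f _ => hD.rightHit_mem f).IsFullyInvariant := by
    intro D hD F a ha
    have := LinearMap.congr_fun (eq_leftHit_of_commute (F.restrictScalars k)
      fun f x => F.map_smul (toConv f) x) a
    change F a ∈ D
    change F a = _ at this
    rw [this]
    exact hD.leftHit_mem _ ha
  have simple : ∀ c ∈ isotypicComponents (WithConv (A →ₗ[k] k)) A,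
      IsSimpleSubcoalgebra (c.restrictScalars k) := by
    intro c hc
    refine ⟨sub_of_inv c (.of_mem_isotypicComponents hc), fun h0 => ?_, fun E hE hsub => ?_⟩
    · refine (bot_lt_isotypicComponents hc).ne' (Submodule.restrictScalars_injective k _ _ ?_)
      rw [h0, Submodule.restrictScalars_bot]
    · set E' := lift E fun f _ => hsub.rightHit_mem f
      have hE' : E' ≤ c := hE
      -- A nonzero subcoalgebra inside `c` contains a simple submodule; full invariance then forces
      -- it to contain the whole isotypic component, which is `c`.
      rcases IsSemisimpleModule.eq_bot_or_exists_simple_le E' with h0 | ⟨S, hS, hsimple⟩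
      · left
        ext x
        change x ∈ E' ↔ _
        rw [h0]
        simp
      · right
        refine le_antisymm hE ?_
        have h1 := eq_isotypicComponent_of_le hc (hS.trans hE')
        have h2 := isFullyInvariant_iff_le_imp_isotypicComponent_le.mp (inv_of_sub E hsub) S hS
        rw [← h1] at h2
        exact h2
  let W : Submodule k A := sSup {D : Submodule k A | IsSimpleSubcoalgebra D}
  have hW : ∀ (f : A →ₗ[k] k), ∀ a ∈ W, rightHit f a ∈ W := by
    intro f
    have : W ≤ W.comap (rightHit f) := sSup_le fun D hD a ha =>
      (le_sSup hD : D ≤ W) (hD.1.rightHit_mem f ha)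
    exact this
  have htop : (⊤ : Submodule (WithConv (A →ₗ[k] k)) A) ≤ lift W hW := by
    rw [← sSup_isotypicComponents]
    exact sSup_le fun c hc a ha =>
      (le_sSup (simple c hc) : c.restrictScalars k ≤ W) ha
  exact eq_top_iff.mpr fun a _ => htop (Submodule.mem_top (x := a))

end DualAction

/-! ### Cosemisimplicity from an integral on `A`. -/

section Integral

variable {k A : Type*} [Field k] [Ring A] [HopfAlgebra k A]

/-- It follows from `∑ Δ(S(y₁))(y₂ ⊗ 1) = 1 ⊗ S(y)`, multiplied on the left by `Δ(x)` and contracted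
with `χ`. -/
theorem sum_leftHit_mul_antipode_eq {ι : Type*} (χ : A →ₗ[k] k) (x : A) {y : A} (r : Repr k y ι) :
    ∑ s ∈ r.index, leftHit (χ ∘ₗ LinearMap.mulRight k (r.right s)) (x * antipode k (r.left s)) =
      leftHit χ x * antipode k y := by
  have h1 : ∀ (w q : A), leftHit (χ ∘ₗ LinearMap.mulRight k q) w =
      TensorProduct.lid k A (χ.rTensor A (comul w * (q ⊗ₜ 1))) := by
    intro w q
    rw [leftHit, LinearMap.comp_apply, LinearMap.comp_apply]
    generalize comul (R := k) w = t
    induction t with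
    | zero => simp
    | add u v hu hv => simp only [map_add, add_mul, hu, hv]
    | tmul u v => simp
  have h2 : (toConv (comul ∘ₗ antipode k : A →ₗ[k] A ⊗[k] A) * toConv (inLeft k A)) y =
      1 ⊗ₜ antipode k y := by
    rw [comul_antipode_conv_inLeft]
    rfl
  rw [r.convMul_apply] at h2
  have h3 : ∀ t : A ⊗[k] A, TensorProduct.lid k A (χ.rTensor A (t * (1 ⊗ₜ antipode k y))) =
      TensorProduct.lid k A (χ.rTensor A t) * antipode k y := by
    intro t
    induction t with
    | zero => simp
    | add u v hu hv => simp only [map_add, add_mul, hu, hv]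
    | tmul u v => simp
  simp only [h1, Bialgebra.comul_mul, ← map_sum, mul_assoc, ← Finset.mul_sum]
  exact (congrArg (fun t => TensorProduct.lid k A (χ.rTensor A (comul x * t))) h2).trans (h3 _)

variable {lam : A →ₗ[k] k}

/-- The map `y ↦ lam(- S(y))` from `A` to its dual algebra is thus linear over that algebra, which
is what the Casimir element needs. Apply `lam` to the preceding identity: invariance reduces each
hit to the scalar `χ(y₂)`. -/
theorem conv_integral (hlam : ∀ (f : A →ₗ[k] k) (a : A), lam (leftHit f a) = f 1 * lam a)
    (χ : A →ₗ[k] k) (y : A) :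
    toConv χ * toConv (lam ∘ₗ LinearMap.mulRight k (antipode k y)) =
      toConv (lam ∘ₗ LinearMap.mulRight k (antipode k (rightHit χ y))) := by
  apply WithConv.ofConv_injective
  rw [conv_eq_comp_leftHit]
  ext x
  have := congrArg lam (sum_leftHit_mul_antipode_eq χ x (ℛ k y))
  simp only [map_sum, hlam] at this
  simp only [LinearMap.comp_apply, LinearMap.mulRight_apply]
  rw [← this, rightHit_apply χ (ℛ k y)]
  simp [Finset.mul_sum]

variable [FiniteDimensional k A]

/-- A finite-dimensional Hopf algebra with an integral `lam` on it such that `lam 1 ≠ 0` is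
cosemisimple. -/
theorem isCosemisimple_of_integral
    (hlam : ∀ (f : A →ₗ[k] k) (a : A), lam (leftHit f a) = f 1 * lam a) (h0 : lam 1 ≠ 0) :
    IsCosemisimple k A := by
  apply isCosemisimple_of_isSemisimpleModule
  let := dualModule k A
  have := isScalarTower_dualModule (k := k) (A := A)
  have b := Module.finBasis k A
  let q : A →ₗ[k] WithConv (A →ₗ[k] k) :=
    { toFun := fun y => toConv (lam ∘ₗ LinearMap.mulRight k (antipode k y))
      map_add' := fun y z => by
        ext x
        simp [mul_add]
      map_smul' := fun c y => by
        ext x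
        simp }
  -- The idempotent is the canonical element of `A ⊗ A*` with its first factor carried to the dual
  -- by `q`. Its product at `a` is `lam(∑ a₁S(a₂)) = ε(a) lam(1)`, whence the normalisation.
  refine isSemisimpleModule_of_casimir (k := k) Finset.univ
    (fun i => (lam 1)⁻¹ • q (b i)) (fun i => toConv (b.coord i)) (fun χ => ?_) ?_
  · suffices H : ∑ i, (χ * q (b i)) ⊗ₜ[k] toConv (b.coord i) =
        ∑ i, q (b i) ⊗ₜ[k] (toConv (b.coord i) * χ) by
      simpa only [mul_smul_comm, ← TensorProduct.smul_tmul', ← Finset.smul_sum] using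
        congrArg ((lam 1)⁻¹ • ·) H
    have h1 : ∀ i, toConv (b.coord i) * χ =
        ∑ j, b.coord i (rightHit χ.ofConv (b j)) • toConv (b.coord j) := by
      intro i
      apply WithConv.ofConv_injective
      refine (conv_eq_comp_rightHit (b.coord i) χ.ofConv).trans (b.ext fun j => ?_)
      simp [Finsupp.single_apply]
    have h2 : ∀ y, χ * q y = q (rightHit χ.ofConv y) := conv_integral hlam χ.ofConv
    have h3 : ∀ y, q y = ∑ i, b.coord i y • q (b i) := by
      intro y
      conv_lhs => rw [← b.sum_repr y, map_sum]
      simp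
    simp only [h1, TensorProduct.tmul_sum, TensorProduct.tmul_smul]
    rw [Finset.sum_comm]
    refine Finset.sum_congr rfl fun j _ => ?_
    rw [h2, h3, TensorProduct.sum_tmul]
    exact Finset.sum_congr rfl fun i _ => by rw [TensorProduct.smul_tmul']
  · apply WithConv.ofConv_injective
    ext a
    have h1 : ∀ i, (q (b i) * toConv (b.coord i)).ofConv a = ∑ s ∈ (ℛ k a).index,
        lam ((ℛ k a).left s * antipode k (b i)) * b.coord i ((ℛ k a).right s) :=
      fun i => (ℛ k a).convMul_apply _ _
    have h2 : ∀ u v, ∑ i, lam (u * antipode k (b i)) * b.coord i v = lam (u * antipode k v) := by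
      intro u v
      conv_rhs => rw [← b.sum_repr v]
      rw [map_sum, Finset.mul_sum, map_sum]
      simp [mul_comm]
    simp only [smul_mul_assoc, ← Finset.smul_sum, ofConv_smul, ofConv_sum, LinearMap.smul_apply,
      LinearMap.sum_apply, h1]
    rw [Finset.sum_comm]
    simp only [h2, ← map_sum, sum_mul_antipode_eq_algebraMap_counit,
      Algebra.algebraMap_eq_smul_one, map_smul, smul_eq_mul]
    rw [mul_comm, mul_assoc, mul_inv_cancel₀ h0, mul_one]
    rfl

/-- A finite-dimensional Hopf algebra in characteristic zero whose antipode is an involution is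
semisimple and cosemisimple. -/
theorem isSemisimpleRing_and_isCosemisimple [CharZero k]
    (h : antipode k (A := A) ∘ₗ antipode k = LinearMap.id) :
    IsSemisimpleRing A ∧ IsCosemisimple k A := by
  have hS : ∀ a : A, antipode k (antipode k a) = a := LinearMap.congr_fun h
  cases subsingleton_or_nontrivial A with
  | inl hA =>
    exact ⟨inferInstance, Subsingleton.elim _ _⟩
  | inr hA =>
  -- Characteristic zero enters here: `dim A` is the value of both `ε(Λ)` and `lam(1)` below.
  have hn : (Module.finrank k A : k) ≠ 0 := Nat.cast_ne_zero.mpr Module.finrank_pos.ne'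
  constructor
  · let F : Module.Dual k A →ₗ[k] k :=
      { toFun := fun f => LinearMap.trace k A (leftHit f)
        map_add' := fun f g => by
          rw [← map_add]
          congr 1
          ext x
          simp [leftHit_apply _ (ℛ k x), add_smul, Finset.sum_add_distrib]
        map_smul' := fun c f => by
          rw [leftHit_smul, map_smul]
          rfl }
    -- Reflexivity of a finite-dimensional space turns the form `f ↦ tr(leftHit f)` on the dual into
    -- an element of `A`.
    obtain ⟨Λ, hΛ⟩ := (Module.evalEquiv k A).surjective F
    have hΛ' : ∀ f : A →ₗ[k] k, f Λ = LinearMap.trace k A (leftHit f) :=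
      fun f => LinearMap.congr_fun hΛ f
    refine isSemisimpleRing_of_integral (k := k) Λ (fun a => ?_) ?_
    · rw [← sub_eq_zero, ← Module.forall_dual_apply_eq_zero_iff k]
      intro f
      have := trace_leftHit_comp_mulLeft hS hS f a
      rw [h, LinearMap.comp_id, LinearMap.comp_id, ← hΛ', ← hΛ'] at this
      rw [map_sub, map_smul, smul_eq_mul, ← this]
      simp
    · rw [hΛ', leftHit_counit, LinearMap.trace_id]
      exact hn
  · refine isCosemisimple_of_integral
      (lam := LinearMap.trace k A ∘ₗ (LinearMap.mul k A).flip) (fun f a => ?_) ?_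
    · exact trace_mulRight_leftHit hS hS (T := LinearMap.id) (fun f => rfl) rfl f a
    · have : (LinearMap.mul k A).flip 1 = LinearMap.id := by
        ext x
        simp
      rw [LinearMap.comp_apply, this, LinearMap.trace_id]
      exact hn

end Integral

end SovereignHopf

end

theorem theorem5p1 {k A : Type*} [Field k] [CharZero k] [Ring A] [HopfAlgebra k A]
    [FiniteDimensional k A] :
    (∀ Φ : SovereignHopf.SovereignCharacter k A,
      (Φ.leftDim (SovereignHopf.RightComodule.regular k A) ≠ 0 ∨ Φ.rightDim (SovereignHopf.RightComodule.regular k A) ≠ 0) →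
        HopfAlgebra.antipode k (A := A) ∘ₗ HopfAlgebra.antipode k = LinearMap.id ∧
          IsSemisimpleRing A ∧ SovereignHopf.IsCosemisimple k A) ∧
    (∀ Φ : SovereignHopf.SovereignElement k A,
      (Φ.leftDim A ≠ 0 ∨ Φ.rightDim A ≠ 0) →
        HopfAlgebra.antipode k (A := A) ∘ₗ HopfAlgebra.antipode k = LinearMap.id ∧
          IsSemisimpleRing A ∧ SovereignHopf.IsCosemisimple k A) :=
  ⟨fun Φ hΦ => ⟨Φ.antipode_comp_antipode hΦ,
      SovereignHopf.isSemisimpleRing_and_isCosemisimple (Φ.antipode_comp_antipode hΦ)⟩,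
    fun Φ hΦ => ⟨Φ.antipode_comp_antipode hΦ,
      SovereignHopf.isSemisimpleRing_and_isCosemisimple (Φ.antipode_comp_antipode hΦ)⟩⟩
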